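/- Let $n\ge 3$ agents and $m\ge 1$ groups be given, with group weights $w_1,\dots,w_m>0$, and put $w_{\max}=\max_j w_j$, $w_{\min}=\min_j w_j$. The type of agent $i$ is $\theta_i=(x_i,g_i)$, where $x_i\in\mathbb{R}$ is her private location and $\emptyset\ne g_i\subseteq\{1,\dots,m\}$ is the publicly known set of groups to which she belongs; let $G_j=\{i: j\in g_i\}$. A deterministic mechanism $f$ for two facilities maps every type profile $\theta=(\theta_1,\dots,\theta_n)$ to a placement $f(\theta)\in\mathbb{R}^2$ of two facilities. For a placement $Y=(y_1,y_2)$ the cost of an agent at $x$ is $c(Y,x)=\min\{|y_1-x|,|y_2-x|\}$. The mechanism $f$ is strategyproof if $c(f(\theta),x_i)\le c(f(\theta'),x_i)$ for all profiles $\theta$, all agents $i$, and all profiles $\theta'$ obtained from $\theta$ by replacing the location $x_i$ of agent $i$ by some $x_i'\in\mathbb{R}$ (keeping $g_i$ and all other types). The weighted maximum group cost of group $j$ is $E_j(\theta,Y)=w_j\max_{i\in G_j}c(Y,x_i)$ (equal to $0$ if $G_j=\emptyset$), the maximum group effect is $\mathrm{MGE}(\theta,Y)=\max_{1\le j\le m}E_j(\theta,Y)$,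 and the approximation ratio of $f$ is $$\rho(f)=\sup_{\theta}\frac{\mathrm{MGE}(\theta,f(\theta))}{\min_{Y\in\mathbb{R}^2}\mathrm{MGE}(\theta,Y)}\in[0,\infty],$$ where a ratio $a/0$ with $a>0$ is $\infty$ and profiles with ratio $0/0$ are disregarded. Then every deterministic strategyproof mechanism $f$ for two facilities satisfies $$\rho(f)\ \ge\ 1+\frac{w_{\max}}{w_{\min}}.$$ -/

import Mathlib

open scoped NNReal ENNReal

namespace FacilityLocation

/-- The type `(x_i, g_i)` of an agent: a (private) location on the real line and the (public)
nonempty set of the groups, among `m` groups, to which the agent belongs. -/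
structure AgentType (m : ℕ) where
  loc : ℝ
  groups : Finset (Fin m)
  groups_nonempty : groups.Nonempty

/-- A type profile of `n` agents. The agents are labelled; no order of the locations is imposed. -/
abbrev Profile (n m : ℕ) : Type := Fin n → AgentType m

/-- A placement of two facilities on the real line. -/
abbrev Placement : Type := ℝ × ℝ

/-- A deterministic mechanism for two facilities. -/
abbrev Mechanism (n m : ℕ) : Type := Profile n m → Placement

/-- The profile in which agent `i` reports the location `x'` (group memberships are public and
cannot be misreported) and all other reports are those of `θ`. -/
def misreport {n m : ℕ} (θ : Profile n m) (i : Fin n) (x' : ℝ) : Profile n m :=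
  Function.update θ i { θ i with loc := x' }

/-- Cost of an agent at `x`: the distance to the nearest facility. -/
noncomputable def cost (Y : Placement) (x : ℝ) : ℝ≥0 :=
  min (nndist Y.1 x) (nndist Y.2 x)

/-- No agent can decrease its cost by misreporting its location, whatever the others report. -/
def Strategyproof {n m : ℕ} (f : Mechanism n m) : Prop :=
  ∀ (θ : Profile n m) (i : Fin n) (x' : ℝ),
    cost (f θ) (θ i).loc ≤ cost (f (misreport θ i x')) (θ i).loc

/-- The set `G_j` of the agents that belong to group `j`. -/
def members {n m : ℕ} (θ : Profile n m) (j : Fin m) : Finset (Fin n) :=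
  {i | j ∈ (θ i).groups}

/-- Weighted maximum group cost `E_j = w_j * max_{i ∈ G_j} c(Y, x_i)`; it is `0` for a group
without members. -/
noncomputable def groupEffect {n m : ℕ} (w : Fin m → ℝ≥0) (θ : Profile n m) (Y : Placement)
    (j : Fin m) : ℝ≥0 :=
  w j * (members θ j).sup fun i => cost Y (θ i).loc

/-- Maximum group effect `max_j E_j`. -/
noncomputable def maxGroupEffect {n m : ℕ} (w : Fin m → ℝ≥0) (θ : Profile n m)
    (Y : Placement) : ℝ≥0 :=
  Finset.univ.sup fun j => groupEffect w θ Y j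

/-- The optimal value of the maximum group effect over all placements of two facilities. -/
noncomputable def optimalEffect {n m : ℕ} (w : Fin m → ℝ≥0) (θ : Profile n m) : ℝ≥0 :=
  ⨅ Y : Placement, maxGroupEffect w θ Y

/-- Approximation ratio of a mechanism: the supremum over all profiles of the ratio between the
effect that it produces and the optimal one. In `ℝ≥0∞` a ratio `a / 0` is `∞` for `a > 0`,
and `0 / 0 = 0`, so that profiles on which both effects vanish do not contribute. -/
noncomputable def approxRatio {n m : ℕ} (w : Fin m → ℝ≥0) (f : Mechanism n m) : ℝ≥0∞ :=
  ⨆ θ : Profile n m, (maxGroupEffect w θ (f θ) : ℝ≥0∞) / (optimalEffect w θ : ℝ≥0∞)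

/-- The maximum group weight. -/
noncomputable def wMax {m : ℕ} (w : Fin m → ℝ≥0) : ℝ≥0 := ⨆ j, w j

/-- The minimum group weight. -/
noncomputable def wMin {m : ℕ} (w : Fin m → ℝ≥0) : ℝ≥0 := ⨅ j, w j

end FacilityLocation

namespace FacilityLocation

/-! Suppose the ratio is below 1 + q/p, with p and q the least and greatest weights. Put one agent
of weight p at a, one of weight q at b, and all the others, of weight q, at c. Strategyproofness
lets the last cluster act as one agent, so three agents remain. The ratio then forces costs below |a
- b| and |a - c| at b and c, and a cost at a of at most a constant times |b - c|. By
`dist2_middle_eq_zero` the middle agent gets a facility. If the outer one does too, the agent at a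
is far from both facilities, so the gap between b and c cannot be too small. `false_of_three_agents`
contradicts this by shrinking an almost minimal gap, letting the two heavy agents exchange roles. -/

/-- The distance from `x` to the nearest facility of `Y`, as a real number. -/
noncomputable def dist2 (Y : Placement) (x : ℝ) : ℝ := min |Y.1 - x| |Y.2 - x|

theorem coe_cost (Y : Placement) (x : ℝ) : (cost Y x : ℝ) = dist2 Y x := by
  simp [cost, dist2, NNReal.coe_min, Real.dist_eq]

theorem dist2_nonneg (Y : Placement) (x : ℝ) : 0 ≤ dist2 Y x :=
  le_min (abs_nonneg _) (abs_nonneg _)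

theorem dist2_eq_zero_iff {Y : Placement} {x : ℝ} : dist2 Y x = 0 ↔ x = Y.1 ∨ x = Y.2 := by
  constructor
  · intro h
    rcases min_choice |Y.1 - x| |Y.2 - x| with h' | h' <;> rw [dist2, h', abs_eq_zero] at h
    · left; linarith
    · right; linarith
  · rintro (h | h) <;> simp [dist2, h]

theorem dist2_le_abs_sub {Y : Placement} {y : ℝ} (hy : dist2 Y y = 0) (x : ℝ) :
    dist2 Y x ≤ |y - x| := by
  rcases dist2_eq_zero_iff.1 hy with rfl | rfl
  · exact min_le_left _ _
  · exact min_le_right _ _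

theorem exists_nearest_facility (Y : Placement) (x : ℝ) :
    ∃ y, dist2 Y y = 0 ∧ |y - x| = dist2 Y x := by
  rcases min_choice |Y.1 - x| |Y.2 - x| with h | h
  · exact ⟨Y.1, dist2_eq_zero_iff.2 (Or.inl rfl), h.symm⟩
  · exact ⟨Y.2, dist2_eq_zero_iff.2 (Or.inr rfl), h.symm⟩

/-- A placement of two facilities occupies at most two points. -/
theorem eq_or_eq_or_eq_of_dist2_eq_zero {Y : Placement} {x y z : ℝ} (hx : dist2 Y x = 0)
    (hy : dist2 Y y = 0) (hz : dist2 Y z = 0) : x = y ∨ y = z ∨ x = z := by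
  rw [dist2_eq_zero_iff] at hx hy hz
  grind

/-- If the second and third agents always get closer to a facility than the first two agents are
to each other, then the second agent gets a facility whenever it lies between the other two. -/
theorem dist2_middle_eq_zero {F : ℝ → ℝ → ℝ → Placement}
    (sp₁ : ∀ a b c a', dist2 (F a b c) a ≤ dist2 (F a' b c) a)
    (sp₂ : ∀ a b c b', dist2 (F a b c) b ≤ dist2 (F a b' c) b)
    (hdiag : ∀ a c, dist2 (F a a c) a = 0)
    (hclose : ∀ a b c, a ≠ b → dist2 (F a b c) b < |a - b| ∧ dist2 (F a b c) c < |a - b|)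
    {a b c : ℝ} (hab : a < b) (hbc : b < c) : dist2 (F a b c) b = 0 := by
  by_contra hb
  -- The reports up to `b` that are granted exactly. The supremum `l` is granted too, since costs
  -- can be compared across reports.
  set S : Set ℝ := {s | s ≤ b ∧ dist2 (F a s c) s = 0} with hS
  have hSne : S.Nonempty := ⟨a, hab.le, hdiag a c⟩
  have hSbdd : BddAbove S := ⟨b, fun s hs => hs.1⟩
  set l := sSup S with hl
  have hlb : l ≤ b := csSup_le hSne fun s hs => hs.1
  have hl0 : dist2 (F a l c) l = 0 := by
    refine le_antisymm (le_of_forall_pos_le_add fun ε hε => ?_) (dist2_nonneg _ _)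
    obtain ⟨s, hs, hls⟩ := exists_lt_of_lt_csSup hSne (show l - ε < sSup S by linarith)
    have hsl : s ≤ l := le_csSup hSbdd hs
    have h := (sp₂ a l c s).trans (dist2_le_abs_sub hs.2 l)
    rw [abs_sub_comm, abs_of_nonneg (by linarith)] at h
    linarith
  have hlb' : l < b := lt_of_le_of_ne hlb fun h => hb (h ▸ hl0)
  -- A third of the gap gives l + 2ε < b - ε < c - ε, so the facilities near l + ε and near `c`
  -- cannot coincide.
  obtain ⟨ε, hε⟩ : ∃ ε, ε = (b - l) / 3 := ⟨_, rfl⟩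
  have hε0 : 0 < ε := by linarith
  have hnear : dist2 (F a (l + ε) c) (l + ε) ≤ ε := by
    have h := (sp₂ a (l + ε) c l).trans (dist2_le_abs_sub hl0 _)
    rwa [abs_sub_comm, abs_of_nonneg (by linarith), add_sub_cancel_left] at h
  obtain ⟨t, ht0, ht⟩ := exists_nearest_facility (F a (l + ε) c) (l + ε)
  have ht' := abs_le.1 (ht.trans_le hnear)
  -- An agent located at `t` could report l + ε, so its truthful report is granted as well.
  -- Maximality of `l` then forces t = l.
  have htS : t ∈ S :=
    ⟨by linarith [ht'.2], le_antisymm ((sp₂ a t c (l + ε)).trans ht0.le) (dist2_nonneg _ _)⟩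
  have htl : t = l := le_antisymm (le_csSup hSbdd htS) (by linarith [ht'.1])
  have hl1 : dist2 (F l (l + ε) c) l = 0 :=
    le_antisymm ((sp₁ l (l + ε) c a).trans (htl ▸ ht0).le) (dist2_nonneg _ _)
  obtain ⟨h2, h3⟩ := hclose l (l + ε) c (by linarith)
  rw [abs_sub_comm, abs_of_nonneg (by linarith), add_sub_cancel_left] at h2 h3
  obtain ⟨y, hy0, hy⟩ := exists_nearest_facility (F l (l + ε) c) (l + ε)
  obtain ⟨z, hz0, hz⟩ := exists_nearest_facility (F l (l + ε) c) c
  have hy' := abs_lt.1 (hy.trans_lt h2)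
  have hz' := abs_lt.1 (hz.trans_lt h3)
  rcases eq_or_eq_or_eq_of_dist2_eq_zero hl1 hy0 hz0 with h | h | h <;> linarith

/-- No strategyproof mechanism for three agents satisfies all these bounds on the costs. -/
theorem false_of_three_agents {F : ℝ → ℝ → ℝ → Placement} {K : ℝ} (hK : 0 < K)
    (sp₁ : ∀ a b c a', dist2 (F a b c) a ≤ dist2 (F a' b c) a)
    (sp₂ : ∀ a b c b', dist2 (F a b c) b ≤ dist2 (F a b' c) b)
    (sp₃ : ∀ a b c c', dist2 (F a b c) c ≤ dist2 (F a b c') c)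
    (hdiag₂ : ∀ a c, dist2 (F a a c) a = 0) (hdiag₃ : ∀ a b, dist2 (F a b a) a = 0)
    (hclose₂ : ∀ a b c, a ≠ b → dist2 (F a b c) b < |a - b| ∧ dist2 (F a b c) c < |a - b|)
    (hclose₃ : ∀ a b c, a ≠ c → dist2 (F a b c) b < |a - c| ∧ dist2 (F a b c) c < |a - c|)
    (hfar : ∀ a b c, dist2 (F a b c) a ≤ K * |b - c|) : False := by
  -- Gaps for which the outermost agent gets a facility. Both assignments of the two heavy agents
  -- are allowed, so that they may change roles below.
  set T : Set ℝ := {g | ∃ e s, 1 ≤ e ∧ e < s ∧ g = s - e ∧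
    (dist2 (F 0 e s) s = 0 ∨ dist2 (F 0 s e) s = 0)} with hT
  have hTne : T.Nonempty := by
    have h := (hclose₂ 0 1 3 (by norm_num)).2
    obtain ⟨s, hs0, hs⟩ := exists_nearest_facility (F 0 1 3) 3
    rw [← hs] at h
    norm_num at h
    refine ⟨s - 1, 1, s, le_rfl, by linarith [(abs_lt.1 h).1], rfl, Or.inl ?_⟩
    exact le_antisymm ((sp₃ 0 1 s 3).trans hs0.le) (dist2_nonneg _ _)
  have hlow : ∀ g ∈ T, 1 / K ≤ g := by
    rintro g ⟨e, s, he, hes, rfl, hs⟩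
    have key : ∀ Y : Placement, dist2 Y e = 0 → dist2 Y s = 0 → dist2 Y 0 ≤ K * (s - e) →
        1 / K ≤ s - e := by
      intro Y he0 hs0 h
      rw [div_le_iff₀ hK]
      obtain ⟨z, hz0, hz⟩ := exists_nearest_facility Y 0
      have hze : e ≤ |z - 0| := by
        rw [sub_zero]
        rcases eq_or_eq_or_eq_of_dist2_eq_zero he0 hs0 hz0 with h | h | h
        · linarith
        · rw [← h]; exact hes.le.trans (le_abs_self _)
        · rw [← h]; exact le_abs_self _
      linarith
    rcases hs with hs | hs
    · refine key _ (dist2_middle_eq_zero sp₁ sp₂ hdiag₂ hclose₂ (by linarith) hes) hs ?_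
      have h := hfar 0 e s
      rwa [abs_sub_comm, abs_of_pos (by linarith)] at h
    · refine key _ (dist2_middle_eq_zero (F := fun a b c => F a c b) (fun a b c => sp₁ a c b)
        (fun a b c => sp₃ a c b) (fun a c => hdiag₃ a c)
        (fun a b c h => (hclose₃ a c b h).symm) (by linarith) hes) hs ?_
      have h := hfar 0 s e
      rwa [abs_of_pos (by linarith)] at h
  have hTbdd : BddBelow T := ⟨1 / K, hlow⟩
  obtain ⟨G, hG⟩ : ∃ G, G = sInf T := ⟨_, rfl⟩
  have hGpos : 0 < G := hG ▸ lt_of_lt_of_le (by positivity) (le_csInf hTne hlow)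
  have hGle : ∀ g ∈ T, G ≤ g := fun g hg => hG ▸ csInf_le hTbdd hg
  obtain ⟨g, hgT, hg⟩ := exists_lt_of_csInf_lt hTne (show sInf T < 3 / 2 * G by linarith)
  have hgG := hGle g hgT
  obtain ⟨e, s, he, hes, rfl, hs⟩ := hgT
  -- Since G ≤ s - e < 3/2 G, any factor in [3/4, 1) would do: both e' - e and s - e' are below G,
  -- and a facility within s - e' of `e'` lies to the right of `e`.
  obtain ⟨e', he'⟩ : ∃ e', e' = e + 4 / 5 * G := ⟨_, rfl⟩
  have habs : |s - e'| = s - e' := abs_of_pos (by linarith)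
  rcases hs with hs | hs
  · have h := (sp₃ 0 e e' s).trans (dist2_le_abs_sub hs e')
    obtain ⟨t, ht0, ht⟩ := exists_nearest_facility (F 0 e e') e'
    rw [← ht, habs, abs_le] at h
    rcases le_or_gt t e' with hte | hte
    · have := hGle (t - e) ⟨e, t, he, by linarith, rfl,
        Or.inl (le_antisymm ((sp₃ 0 e t e').trans ht0.le) (dist2_nonneg _ _))⟩
      linarith
    -- Here the agent at `e` moves out to `t`, leaving the other one at `e'` in the middle.
    · have := hGle (t - e') ⟨e', t, by linarith, hte, rfl,
        Or.inr (le_antisymm ((sp₂ 0 t e' e).trans ht0.le) (dist2_nonneg _ _))⟩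
      linarith
  · have h := (sp₂ 0 e' e s).trans (dist2_le_abs_sub hs e')
    obtain ⟨t, ht0, ht⟩ := exists_nearest_facility (F 0 e' e) e'
    rw [← ht, habs, abs_le] at h
    rcases le_or_gt t e' with hte | hte
    · have := hGle (t - e) ⟨e, t, he, by linarith, rfl,
        Or.inr (le_antisymm ((sp₂ 0 t e e').trans ht0.le) (dist2_nonneg _ _))⟩
      linarith
    · have := hGle (t - e') ⟨e', t, by linarith, hte, rfl,
        Or.inl (le_antisymm ((sp₃ 0 e' t e).trans ht0.le) (dist2_nonneg _ _))⟩
      linarith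

section Profiles

variable {n m : ℕ}

/-- The profile with locations `x` in which agent `i` belongs to the group `γ i` only. -/
def singletonProfile (γ : Fin n → Fin m) (x : Fin n → ℝ) : Profile n m :=
  fun i => ⟨x i, {γ i}, Finset.singleton_nonempty _⟩

theorem misreport_singletonProfile (γ : Fin n → Fin m) (x : Fin n → ℝ) (i : Fin n) (x' : ℝ) :
    misreport (singletonProfile γ x) i x' = singletonProfile γ (Function.update x i x') := by
  funext k
  by_cases h : k = i
  · subst h; simp [misreport, singletonProfile]
  · simp [misreport, singletonProfile, h]

theorem Strategyproof.dist2_update_le {f : Mechanism n m} (hf : Strategyproof f)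
    (γ : Fin n → Fin m) (x : Fin n → ℝ) (i : Fin n) (x' : ℝ) :
    dist2 (f (singletonProfile γ x)) (x i) ≤
      dist2 (f (singletonProfile γ (Function.update x i x'))) (x i) := by
  have h := hf (singletonProfile γ x) i x'
  rw [misreport_singletonProfile] at h
  rw [← coe_cost, ← coe_cost]
  exact_mod_cast h

/-- Agents at the same location do not gain from reporting jointly another location. -/
theorem Strategyproof.dist2_le_of_coalition {f : Mechanism n m} (hf : Strategyproof f)
    (γ : Fin n → Fin m) (x : Fin n → ℝ) (S : Finset (Fin n)) {c : ℝ} (hc : ∀ i ∈ S, x i = c)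
    (c' : ℝ) :
    dist2 (f (singletonProfile γ x)) c ≤
      dist2 (f (singletonProfile γ fun i => if i ∈ S then c' else x i)) c := by
  induction S using Finset.induction_on with
  | empty => simp
  | insert i S hi ih =>
    refine (ih fun k hk => hc k (Finset.mem_insert_of_mem hk)).trans ?_
    have h := hf.dist2_update_le γ (fun k => if k ∈ S then c' else x k) i c'
    have hx : (fun k => if k ∈ insert i S then c' else x k) =
        Function.update (fun k => if k ∈ S then c' else x k) i c' := by
      funext k
      by_cases hk : k = i
      · subst hk; simp
      · simp [hk]
    rw [hx]
    simpa only [if_neg hi, hc i (Finset.mem_insert_self i S)] using h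

theorem mul_cost_le_maxGroupEffect (w : Fin m → ℝ≥0) (γ : Fin n → Fin m) (x : Fin n → ℝ)
    (Y : Placement) (i : Fin n) :
    w (γ i) * cost Y (x i) ≤ maxGroupEffect w (singletonProfile γ x) Y := by
  refine le_trans ?_ (Finset.le_sup (f := fun j => groupEffect w (singletonProfile γ x) Y j)
    (Finset.mem_univ (γ i)))
  refine mul_le_mul_right ?_ _
  exact Finset.le_sup (f := fun k => cost Y (singletonProfile γ x k).loc)
    (by simp [members, singletonProfile])

theorem optimalEffect_le (w : Fin m → ℝ≥0) (γ : Fin n → Fin m) (x : Fin n → ℝ) (Y : Placement)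
    {B : ℝ} (hB : 0 ≤ B) (h : ∀ i, w (γ i) * dist2 Y (x i) ≤ B) :
    (optimalEffect w (singletonProfile γ x) : ℝ) ≤ B := by
  lift B to ℝ≥0 using hB
  rw [NNReal.coe_le_coe]
  refine (ciInf_le' _ Y).trans (Finset.sup_le fun j _ => ?_)
  rw [groupEffect, NNReal.mul_finset_sup]
  refine Finset.sup_le fun i hi => ?_
  have hij : j = γ i := by simpa [members, singletonProfile] using hi
  have h' := h i
  rw [← coe_cost] at h'
  subst hij
  exact_mod_cast h'

end Profiles

/-- The second alternative covers optimum 0, where a finite ratio forces effect 0. -/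
theorem effect_lt_or_eq_zero {n m : ℕ} {w : Fin m → ℝ≥0} {f : Mechanism n m} {ρ : ℝ≥0}
    (h : approxRatio w f < ρ) (θ : Profile n m) :
    maxGroupEffect w θ (f θ) < ρ * optimalEffect w θ ∨ maxGroupEffect w θ (f θ) = 0 := by
  have hθ := (le_iSup (fun θ : Profile n m => (maxGroupEffect w θ (f θ) : ℝ≥0∞) /
    (optimalEffect w θ : ℝ≥0∞)) θ).trans_lt h
  rcases eq_or_ne (optimalEffect w θ) 0 with h0 | h0
  · right
    by_contra hne
    rw [h0, ENNReal.coe_zero, ENNReal.div_zero (by exact_mod_cast hne)] at hθ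
    exact not_top_lt hθ
  · left
    rw [ENNReal.div_lt_iff (Or.inl (by exact_mod_cast h0)) (Or.inl ENNReal.coe_ne_top)] at hθ
    exact_mod_cast hθ

/-- A mechanism whose approximation ratio is less than `ρ` beats `ρ` times any bound on the
effect of a placement. -/
theorem mul_dist2_lt_or_eq_zero {n m : ℕ} {w : Fin m → ℝ≥0} {f : Mechanism n m} {ρ : ℝ≥0}
    (h : approxRatio w f < ρ) (γ : Fin n → Fin m) (x : Fin n → ℝ) (Y : Placement) {B : ℝ}
    (hB : 0 ≤ B) (hY : ∀ i, w (γ i) * dist2 Y (x i) ≤ B) (i : Fin n) :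
    w (γ i) * dist2 (f (singletonProfile γ x)) (x i) < ρ * B ∨
      w (γ i) * dist2 (f (singletonProfile γ x)) (x i) = 0 := by
  have h1 := mul_cost_le_maxGroupEffect w γ x (f (singletonProfile γ x)) i
  have h2 := optimalEffect_le w γ x Y hB hY
  rw [← coe_cost]
  rcases effect_lt_or_eq_zero h (singletonProfile γ x) with h3 | h3
  · left
    have h4 : ((w (γ i) * cost (f (singletonProfile γ x)) (x i) : ℝ≥0) : ℝ) <
        ((ρ * optimalEffect w (singletonProfile γ x) : ℝ≥0) : ℝ) := by
      exact_mod_cast h1.trans_lt h3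
    push_cast at h4
    exact h4.trans_le (mul_le_mul_of_nonneg_left h2 ρ.2)
  · right
    rw [h3] at h1
    exact_mod_cast le_antisymm h1 zero_le

end FacilityLocation

theorem mainTheorem6 (n m : ℕ) (hn : 3 ≤ n) (hm : 1 ≤ m) (w : Fin m → ℝ≥0)
    (hw : ∀ j, 0 < w j) (f : FacilityLocation.Mechanism n m)
    (hf : FacilityLocation.Strategyproof f) :
    ((1 + FacilityLocation.wMax w / FacilityLocation.wMin w : ℝ≥0) : ℝ≥0∞) ≤
      FacilityLocation.approxRatio w f := by
  open FacilityLocation in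
  have : Nonempty (Fin m) := ⟨⟨0, hm⟩⟩
  obtain ⟨jmax, hmax⟩ := exists_eq_ciSup_of_finite (f := w)
  obtain ⟨jmin, hmin⟩ := exists_eq_ciInf_of_finite (f := w)
  by_contra! hlt
  rw [show wMax w = w jmax from hmax.symm, show wMin w = w jmin from hmin.symm] at hlt
  let γ : Fin n → Fin m := fun i => if i.val = 0 then jmin else jmax
  let loc : ℝ → ℝ → ℝ → Fin n → ℝ := fun a b c i =>
    if i.val = 0 then a else if i.val = 1 then b else c
  let F : ℝ → ℝ → ℝ → Placement := fun a b c => f (singletonProfile γ (loc a b c))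
  obtain ⟨p, hp⟩ : ∃ p : ℝ, p = w jmin := ⟨_, rfl⟩
  obtain ⟨q, hq⟩ : ∃ q : ℝ, q = w jmax := ⟨_, rfl⟩
  have hp0 : 0 < p := by rw [hp]; exact_mod_cast hw jmin
  have hq0 : 0 < q := by rw [hq]; exact_mod_cast hw jmax
  have hbound : ∀ (a b c : ℝ) (Y : Placement) (B : ℝ), 0 ≤ B → p * dist2 Y a ≤ B →
      q * dist2 Y b ≤ B → q * dist2 Y c ≤ B →
      (p * dist2 (F a b c) a < (1 + q / p) * B ∨ p * dist2 (F a b c) a = 0) ∧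
      (q * dist2 (F a b c) b < (1 + q / p) * B ∨ q * dist2 (F a b c) b = 0) ∧
      (q * dist2 (F a b c) c < (1 + q / p) * B ∨ q * dist2 (F a b c) c = 0) := by
    intro a b c Y B hB ha hb hc
    have h := mul_dist2_lt_or_eq_zero hlt γ (loc a b c) Y hB fun i => by
      by_cases h0 : i.val = 0
      · simpa [γ, loc, h0, ← hp] using ha
      · by_cases h1 : i.val = 1
        · simpa [γ, loc, h1, ← hq] using hb
        · simpa [γ, loc, h0, h1, ← hq] using hc
    have h1 := h ⟨0, by omega⟩
    have h2 := h ⟨1, by omega⟩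
    have h3 := h ⟨2, by omega⟩
    simp only [γ, loc, NNReal.coe_add, NNReal.coe_one, NNReal.coe_div, ← hp, ← hq, if_true,
      one_ne_zero, two_ne_zero, if_false, OfNat.ofNat_ne_one] at h1 h2 h3
    exact ⟨h1, h2, h3⟩
  have hcoalition : ∀ (x : Fin n → ℝ) (P : Fin n → Prop) [DecidablePred P] (c c' : ℝ),
      (∀ i, P i → x i = c) → dist2 (f (singletonProfile γ x)) c ≤
        dist2 (f (singletonProfile γ fun i => if P i then c' else x i)) c := by
    intro x P _ c c' hP
    simpa using hf.dist2_le_of_coalition γ x {i | P i} (c := c) (by simpa using hP) c'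
  -- The point between `a` and `b` that equalizes the two weighted costs.
  have hpair : ∀ a b : ℝ, ∃ y, p * |y - a| = p * q / (p + q) * |a - b| ∧
      q * |y - b| = p * q / (p + q) * |a - b| := by
    intro a b
    refine ⟨b + p / (p + q) * (a - b), ?_, ?_⟩
    · rw [show b + p / (p + q) * (a - b) - a = -(q / (p + q) * (a - b)) by field_simp; ring,
        abs_neg, abs_mul, abs_of_pos (by positivity)]
      ring
    · rw [add_sub_cancel_left, abs_mul, abs_of_pos (by positivity)]
      ring
  -- This is where 1 + q/p is critical: it turns the balanced cost of a pair into `q` times its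
  -- distance.
  have hmul : ∀ t : ℝ, (1 + q / p) * (p * q / (p + q) * t) = q * t := by
    intro t
    field_simp
  have hlt_of : ∀ s t : ℝ, 0 < t → (q * s < q * t ∨ q * s = 0) → s < t := by
    rintro s t ht (h | h)
    · exact lt_of_mul_lt_mul_left h hq0.le
    · rwa [(mul_eq_zero.1 h).resolve_left hq0.ne']
  have hzero_of : ∀ s : ℝ, 0 ≤ s → (q * s < (1 + q / p) * 0 ∨ q * s = 0) → s = 0 := by
    rintro s hs (h | h)
    · rw [mul_zero] at h
      exact absurd h (not_lt.2 (by positivity))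
    · exact (mul_eq_zero.1 h).resolve_left hq0.ne'
  have hleft : ∀ y z : ℝ, dist2 (y, z) y = 0 := fun y z => dist2_eq_zero_iff.2 (Or.inl rfl)
  have hright : ∀ y z : ℝ, dist2 (y, z) z = 0 := fun y z => dist2_eq_zero_iff.2 (Or.inr rfl)
  refine false_of_three_agents (F := F) (K := (1 + q / p) * q / p) (by positivity)
    ?_ ?_ ?_ ?_ ?_ ?_ ?_ ?_
  · intro a b c a'
    convert hcoalition (loc a b c) (fun i => i.val = 0) a a' (by simp +contextual [loc]) using 4
    funext i
    grind
  · intro a b c b'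
    convert hcoalition (loc a b c) (fun i => i.val = 1) b b' (by simp +contextual [loc]) using 4
    funext i
    grind
  · intro a b c c'
    convert hcoalition (loc a b c) (fun i => i.val ≠ 0 ∧ i.val ≠ 1) c c'
      (by simp +contextual [loc]) using 4
    funext i
    grind
  · intro a c
    refine hzero_of _ (dist2_nonneg _ _) (hbound a a c (a, c) 0 le_rfl ?_ ?_ ?_).2.1 <;>
      simp [hleft, hright]
  · intro a b
    refine hzero_of _ (dist2_nonneg _ _) (hbound a b a (a, b) 0 le_rfl ?_ ?_ ?_).2.2 <;>
      simp [hleft, hright]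
  · intro a b c hab
    have hpos : 0 < |a - b| := abs_pos.2 (sub_ne_zero.2 hab)
    obtain ⟨y, hya, hyb⟩ := hpair a b
    have h := hbound a b c (y, c) (p * q / (p + q) * |a - b|) (by positivity)
      (hya ▸ mul_le_mul_of_nonneg_left (dist2_le_abs_sub (hleft y c) a) hp0.le)
      (hyb ▸ mul_le_mul_of_nonneg_left (dist2_le_abs_sub (hleft y c) b) hq0.le)
      (by rw [hright, mul_zero]; positivity)
    rw [hmul] at h
    exact ⟨hlt_of _ _ hpos h.2.1, hlt_of _ _ hpos h.2.2⟩
  · intro a b c hac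
    have hpos : 0 < |a - c| := abs_pos.2 (sub_ne_zero.2 hac)
    obtain ⟨y, hya, hyc⟩ := hpair a c
    have h := hbound a b c (y, b) (p * q / (p + q) * |a - c|) (by positivity)
      (hya ▸ mul_le_mul_of_nonneg_left (dist2_le_abs_sub (hleft y b) a) hp0.le)
      (by rw [hright, mul_zero]; positivity)
      (hyc ▸ mul_le_mul_of_nonneg_left (dist2_le_abs_sub (hleft y b) c) hq0.le)
    rw [hmul] at h
    exact ⟨hlt_of _ _ hpos h.2.1, hlt_of _ _ hpos h.2.2⟩
  · intro a b c
    have h := (hbound a b c (a, b) (q * |b - c|) (by positivity)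
      (by rw [hleft, mul_zero]; positivity) (by rw [hright, mul_zero]; positivity)
      (mul_le_mul_of_nonneg_left (dist2_le_abs_sub (hright a b) c) hq0.le)).1
    rw [show (1 + q / p) * q / p * |b - c| = (1 + q / p) * (q * |b - c|) / p by ring,
      le_div_iff₀ hp0, mul_comm]
    rcases h with h | h
    · exact h.le
    · rw [h]; positivity
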